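/- For an integer $k\ge 1$ and complex $q$ with $|q|<1$ let $$S_k(q)=\sum_{m=1}^{\infty}\frac{1}{m^k}\,\frac{q^m}{1-q^m},$$ and put $q_2=e^{-\pi\sqrt2}$ and $\sqrt{-2}=i\sqrt2$. For $n\ge 1$ and $z\in\mathbb{C}\setminus\{0\}$ let $$b_n=3^{2n+1}-(-2)^n-(1+\sqrt{-2})^{2n}-(1-\sqrt{-2})^{2n},$$ $$\mathcal{H}_n(z)=(-1)^{n+1}\sum_{m=0}^{n+1}z^{2m-1}\binom{2n+2}{2m}\mathcal{B}_{2m}\mathcal{B}_{2n+2-2m},$$ where $\mathcal{B}_j$ are the Bernoulli numbers. Let $n\ge1$ and $k=2n+1$. Then $b_n$ is a positive integer, the series $S_k(q_2^d)$ converge absolutely for $d\in\{2,3,6\}$, and there are rational numbers $B_{k,0},B_{k,2},B_{k,3},B_{k,6}$ with $$\zeta(k)=B_{k,0}\sqrt2\,\pi^k+\sum_{d\in\{2,3,6\}}B_{k,d}\,S_k(q_2^d),$$ which are given by $$B_{k,6}=\frac{B_{k,3}}{(-2)^n}=\frac{2}{b_n},\qquad B_{k,2}+B_{k,3}+B_{k,6}=-2,$$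 $$\frac{(2n+3)!}{2^{2n-1}}\,b_n\,B_{k,0}=\frac{4(2n+3)\,3^{2n}}{\sqrt2}\,\operatorname{Im}\!\left(2\mathcal{H}_n\!\left(\frac{1+\sqrt{-2}}{3}\right)+\mathcal{H}_n\!\left(\frac{\sqrt{-2}}{3}\right)\right).$$ -/

import Mathlib

open scoped Nat

noncomputable section

/-- The `m`-th term `m^{-k} q^m / (1 - q^m)` of the Lambert series `S_k(q)`. -/
def lambertTerm (k : ℕ) (q : ℂ) (m : ℕ+) : ℂ :=
  1 / ((m : ℕ) : ℂ) ^ k * (q ^ (m : ℕ) / (1 - q ^ (m : ℕ)))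

/-- `S_k(q)`, the sum of the terms above over all integers `m ≥ 1`. -/
def lambertS (k : ℕ) (q : ℂ) : ℂ := ∑' m : ℕ+, lambertTerm k q m

/-- The nome `q_2 = exp (-π √2)`. -/
def q2 : ℝ := Real.exp (-(Real.pi * √2))

/-- `√(-2) = i √2`. -/
def sqrtNegTwo : ℂ := Complex.I * ((√2 : ℝ) : ℂ)

/-- `b_n = 3^{2n+1} - (-2)^n - (1 + √(-2))^{2n} - (1 - √(-2))^{2n}`. -/
def bSeq (n : ℕ) : ℂ :=
  3 ^ (2 * n + 1) - (-2) ^ n - (1 + sqrtNegTwo) ^ (2 * n) - (1 - sqrtNegTwo) ^ (2 * n)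

/-- `H_n(z) = (-1)^{n+1} ∑_{m=0}^{n+1} z^{2m-1} C(2n+2, 2m) B_{2m} B_{2n+2-2m}`, where the
`B_j` are the Bernoulli numbers. -/
def bernoulliH (n : ℕ) (z : ℂ) : ℂ :=
  (-1) ^ (n + 1) * ∑ m ∈ Finset.range (n + 2),
    z ^ (2 * (m : ℤ) - 1) * ((2 * n + 2).choose (2 * m) : ℂ) *
      ((bernoulli (2 * m) : ℚ) : ℂ) * ((bernoulli (2 * n + 2 - 2 * m) : ℚ) : ℂ)

end

noncomputable section

/-! Let F(τ) = ζ(k)/2 + S_k(e^{2πiτ}) (`completedLambert`), an Eichler integral of the Eisenstein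
series of weight 2n+2. It has period 1. Ramanujan's formula `completedLambert_sub_neg_inv` makes
F(τ) − τ^{2n} F(−1/τ) an explicit multiple of H_n(τ), and the Hecke relation
`completedLambert_hecke` ties τ/3, (τ±1)/3 and 3τ to τ.

At τ = √-2, inversion carries (τ±1)/3 to τ∓1 and τ/3 to 3τ/2. What remains is one linear relation
between F(τ), F(3τ/2), F(3τ), whose nomes are q_2^2, q_2^3, q_2^6
(`completedLambert_sqrtNegTwo_relation`). Its constant terms add up to b_n ζ(k)/2, and b_n > 0, so
it can be solved for ζ(k). The Bernoulli side lies in ℚ(√-2), where imaginary parts are rational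
multiples of √2. -/

/-! ### Lambert series and their Hecke relation at 3. -/

theorem norm_lambertTerm_le (k : ℕ) {q : ℂ} (hq : ‖q‖ < 1) (m : ℕ+) :
    ‖lambertTerm k q m‖ ≤ ‖q‖ ^ (m : ℕ) * (1 - ‖q‖)⁻¹ := by
  have hm : (1 : ℝ) ≤ (m : ℕ) := by exact_mod_cast m.pos
  have h1 : ‖q‖ ^ (m : ℕ) ≤ ‖q‖ := pow_le_of_le_one (norm_nonneg _) hq.le m.ne_zero
  have h2 : 1 - ‖q‖ ≤ ‖1 - q ^ (m : ℕ)‖ := by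
    have := norm_sub_norm_le (1 : ℂ) (q ^ (m : ℕ))
    rw [norm_one, norm_pow] at this
    linarith
  have h3 : 0 < 1 - ‖q‖ := by linarith
  have h4 : 1 / ((m : ℕ) : ℝ) ^ k ≤ 1 := div_le_one_of_le₀ (one_le_pow₀ hm) (by positivity)
  rw [lambertTerm, norm_mul, norm_div, norm_div, norm_one, norm_pow, norm_pow, Complex.norm_natCast,
    div_eq_mul_inv (‖q‖ ^ (m : ℕ))]
  calc _ ≤ 1 * (‖q‖ ^ (m : ℕ) * ‖1 - q ^ (m : ℕ)‖⁻¹) := by gcongr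
    _ ≤ _ := by rw [one_mul]; gcongr

theorem summable_lambertTerm (k : ℕ) {q : ℂ} (hq : ‖q‖ < 1) : Summable (lambertTerm k q) := by
  refine Summable.of_norm_bounded ?_ (norm_lambertTerm_le k hq)
  refine Summable.mul_right _ ?_
  exact (summable_geometric_of_lt_one (norm_nonneg q) hq).comp_injective PNat.coe_injective

theorem one_sub_ne_zero_of_norm_lt_one {x : ℂ} (hx : ‖x‖ < 1) : 1 - x ≠ 0 := by
  intro h
  rw [← sub_eq_zero.mp h, norm_one] at hx
  exact lt_irrefl _ hx

/-- Averaging the geometric series of x over the cube roots of unity keeps only the exponents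
divisible by 3. -/
theorem sum_cubeRoots_div_one_sub {ω x : ℂ} (hω : ω ^ 2 + ω + 1 = 0) (hx : ‖x‖ < 1) :
    x / (1 - x) + ω * x / (1 - ω * x) + ω ^ 2 * x / (1 - ω ^ 2 * x) = 3 * (x ^ 3 / (1 - x ^ 3)) := by
  have h3 : ω ^ 3 = 1 := by linear_combination (ω - 1) * hω
  have hn : ‖ω‖ = 1 := Complex.norm_eq_one_of_pow_eq_one h3 (by norm_num)
  have e1 := one_sub_ne_zero_of_norm_lt_one hx
  have e2 : 1 - ω * x ≠ 0 := one_sub_ne_zero_of_norm_lt_one (by simpa [hn] using hx)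
  have e3 : 1 - ω ^ 2 * x ≠ 0 := one_sub_ne_zero_of_norm_lt_one (by simpa [hn] using hx)
  have e4 : 1 - x ^ 3 = (1 - x) * (1 - ω * x) * (1 - ω ^ 2 * x) := by
    linear_combination (x - x ^ 2 * ω) * hω + x ^ 3 * h3
  rw [e4, div_add_div _ _ e1 e2, div_add_div _ _ (mul_ne_zero e1 e2) e3, ← mul_div_assoc]
  congr 1
  linear_combination (x - 2 * x ^ 2 * ω) * hω + 3 * x ^ 3 * h3

/-- If 3 ∤ m, then ω^m is again a primitive cube root of unity and the averaging identity applies.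
If 3 ∣ m, the three terms coincide, which produces the correction. -/
theorem sum_lambertTerm_cubeRoots (k : ℕ) {ω q : ℂ} (hω : ω ^ 2 + ω + 1 = 0) (hq : ‖q‖ < 1)
    (m : ℕ+) :
    lambertTerm k q m + lambertTerm k (ω * q) m + lambertTerm k (ω ^ 2 * q) m =
      3 * lambertTerm k (q ^ 3) m +
        if 3 ∣ (m : ℕ) then 3 * (lambertTerm k q m - lambertTerm k (q ^ 3) m) else 0 := by
  have h3 : ω ^ 3 = 1 := by linear_combination (ω - 1) * hω
  have key : ∀ r : ℕ, (m : ℕ) % 3 = r → ω ^ (m : ℕ) = ω ^ r := by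
    intro r hr
    rw [← Nat.div_add_mod (m : ℕ) 3, hr, pow_add, pow_mul, h3, one_pow, one_mul]
  have e2 : (ω ^ 2 * q) ^ (m : ℕ) = (ω ^ (m : ℕ)) ^ 2 * q ^ (m : ℕ) := by
    rw [mul_pow, pow_right_comm]
  have hx : ‖q ^ (m : ℕ)‖ < 1 := by
    rw [norm_pow]; exact pow_lt_one₀ (norm_nonneg _) hq m.ne_zero
  simp only [lambertTerm]
  rw [e2, mul_pow, pow_right_comm q 3]
  set x := q ^ (m : ℕ)
  split_ifs with h
  · rw [key 0 (Nat.mod_eq_zero_of_dvd h)]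
    simp only [pow_zero, one_pow, one_mul]
    ring
  · have hs : (ω ^ (m : ℕ)) ^ 2 + ω ^ (m : ℕ) + 1 = 0 := by
      have : (m : ℕ) % 3 = 1 ∨ (m : ℕ) % 3 = 2 := by omega
      rcases this with h | h <;> rw [key _ h]
      · linear_combination hω
      · linear_combination (ω ^ 2 - ω + 1) * hω
    have := sum_cubeRoots_div_one_sub hs hx
    linear_combination 1 / ((m : ℕ) : ℂ) ^ k * this

/-- The Hecke relation at `3` for the Lambert series `S_k`. -/
theorem sum_lambertS_cubeRoots (k : ℕ) {ω q : ℂ} (hω : ω ^ 2 + ω + 1 = 0) (hq : ‖q‖ < 1) :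
    lambertS k q + lambertS k (ω * q) + lambertS k (ω ^ 2 * q) =
      3 * lambertS k (q ^ 3) + 3 / 3 ^ k * (lambertS k (q ^ 3) - lambertS k (q ^ 9)) := by
  have h3 : ω ^ 3 = 1 := by linear_combination (ω - 1) * hω
  have hn : ‖ω‖ = 1 := Complex.norm_eq_one_of_pow_eq_one h3 (by norm_num)
  have s1 := summable_lambertTerm k hq
  have s2 : Summable (lambertTerm k (ω * q)) := summable_lambertTerm k (by simpa [hn] using hq)
  have s3 : Summable (lambertTerm k (ω ^ 2 * q)) := summable_lambertTerm k (by simpa [hn] using hq)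
  have hp : ∀ j ≠ 0, ‖q ^ j‖ < 1 := fun j hj => by
    rw [norm_pow]; exact pow_lt_one₀ (norm_nonneg _) hq hj
  have s4 := summable_lambertTerm k (hp 3 (by norm_num))
  have s5 := summable_lambertTerm k (hp 9 (by norm_num))
  -- The correction lives on multiples of 3; substituting 3m for m yields the factor 3^{-k} and
  -- replaces q by q^3.
  let g : ℕ+ → ℕ+ := fun m => 3 * m
  have hg : Function.Injective g := fun a b h => mul_left_cancel h
  let f : ℕ+ → ℂ := fun m =>
    if 3 ∣ (m : ℕ) then 3 * (lambertTerm k q m - lambertTerm k (q ^ 3) m) else 0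
  have hf : Function.support f ⊆ Set.range g := by
    intro m hm
    have h : 3 ∣ (m : ℕ) := by
      by_contra h
      exact hm (if_neg h)
    obtain ⟨c, hc⟩ := h
    have hc0 : 0 < c := by
      have := m.pos
      omega
    exact ⟨Nat.toPNat c hc0, PNat.eq (by simp only [g, PNat.mul_coe]; exact hc.symm)⟩
  have hfg : ∀ m, f (g m) = 3 / 3 ^ k * (lambertTerm k (q ^ 3) m - lambertTerm k (q ^ 9) m) := by
    intro m
    have : ((g m : ℕ+) : ℕ) = 3 * m := by simp [g]
    simp only [f, this, dvd_mul_right, if_true, lambertTerm, ← pow_mul]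
    push_cast
    rw [mul_pow, ← mul_assoc 3 3 (m : ℕ)]
    norm_num
    ring
  have hsum : ∑' m, f m = 3 / 3 ^ k * (lambertS k (q ^ 3) - lambertS k (q ^ 9)) := by
    rw [← hg.tsum_eq hf]
    simp only [hfg]
    rw [tsum_mul_left, s4.tsum_sub s5]
    rfl
  have hsf : Summable f := by
    have : f = fun m => (lambertTerm k q m + lambertTerm k (ω * q) m + lambertTerm k (ω ^ 2 * q) m)
        - 3 * lambertTerm k (q ^ 3) m := by
      funext m
      rw [sum_lambertTerm_cubeRoots k hω hq m]
      simp [f]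
    rw [this]
    exact ((s1.add s2).add s3).sub (s4.mul_left 3)
  rw [← hsum]
  simp only [lambertS]
  rw [← s1.tsum_add s2, ← (s1.add s2).tsum_add s3, ← tsum_mul_left,
    ← (s4.mul_left 3).tsum_add hsf]
  exact tsum_congr fun m => sum_lambertTerm_cubeRoots k hω hq m

/-! ### Cotangent double series and Ramanujan's formula. -/

theorem hasSum_one_div_pnat_pow {k : ℕ} (hk : 1 < k) :
    HasSum (fun m : ℕ+ => 1 / ((m : ℕ) : ℂ) ^ k) (riemannZeta k) := by
  have hs : Summable (fun m : ℕ => 1 / (m : ℂ) ^ k) := by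
    refine (Complex.summable_ofReal.mpr (Real.summable_one_div_nat_pow.mpr hk)).congr fun m => ?_
    push_cast
    rfl
  have h0 : Summable (fun m : ℕ+ => 1 / ((m : ℕ) : ℂ) ^ k) :=
    hs.comp_injective PNat.coe_injective
  rw [h0.hasSum_iff, zeta_nat_eq_tsum_of_gt_one hk]
  refine PNat.coe_injective.tsum_eq (f := fun m : ℕ => 1 / (m : ℂ) ^ k) fun m hm => ?_
  rcases Nat.eq_zero_or_pos m with rfl | h
  · simp [show k ≠ 0 by omega] at hm
  · exact ⟨⟨m, h⟩, rfl⟩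

/-- The terms of the double series `∑ m^{-2n} / (m² τ² - l²)`. -/
def cotDoubleTerm (n : ℕ) (τ : ℂ) (p : ℕ+ × ℕ+) : ℂ :=
  1 / (((p.1 : ℕ) : ℂ) ^ (2 * n) * (((p.1 : ℕ) : ℂ) ^ 2 * τ ^ 2 - ((p.2 : ℕ) : ℂ) ^ 2))

/-- Both factors xτ ∓ y have imaginary part x · Im τ. -/
theorem le_norm_sq_mul_sq_sub_sq {τ : ℂ} (hτ : 0 < τ.im) (x y : ℝ) :
    x ^ 2 * τ.im ^ 2 ≤ ‖(x : ℂ) ^ 2 * τ ^ 2 - (y : ℂ) ^ 2‖ := by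
  have h : ∀ y : ℝ, |x| * τ.im ≤ ‖(x : ℂ) * τ - y‖ := fun y => by
    have := Complex.abs_im_le_norm ((x : ℂ) * τ - y)
    simpa [abs_mul, abs_of_pos hτ] using this
  have h1 := h y
  have h2 := h (-y)
  have e : (x : ℂ) ^ 2 * τ ^ 2 - (y : ℂ) ^ 2 = (x * τ - y) * (x * τ - (-y : ℝ)) := by
    push_cast; ring
  rw [e, norm_mul]
  calc x ^ 2 * τ.im ^ 2 = (|x| * τ.im) * (|x| * τ.im) := by rw [← sq_abs x]; ring
    _ ≤ _ := by gcongr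

theorem im_neg_inv_pos {τ : ℂ} (hτ : 0 < τ.im) : 0 < (-1 / τ).im := by
  have : τ ≠ 0 := by rintro rfl; simp at hτ
  have := Complex.normSq_pos.mpr this
  rw [neg_div, one_div, Complex.neg_im, Complex.inv_im]
  rw [neg_div, neg_neg]; positivity

/-- Applying the previous bound at −1/τ exchanges x and y, so the growth is controlled by y instead.
-/
theorem exists_le_norm_sq_mul_sq_sub_sq {τ : ℂ} (hτ : 0 < τ.im) :
    ∃ c : ℝ, 0 < c ∧ ∀ x y : ℝ, c * y ^ 2 ≤ ‖(x : ℂ) ^ 2 * τ ^ 2 - (y : ℂ) ^ 2‖ := by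
  have h0 : τ ≠ 0 := by rintro rfl; simp at hτ
  have hn : 0 < ‖τ‖ := norm_pos_iff.mpr h0
  have hi := im_neg_inv_pos hτ
  refine ⟨‖τ‖ ^ 2 * (-1 / τ).im ^ 2, by positivity, fun x y => ?_⟩
  have := le_norm_sq_mul_sq_sub_sq hi y x
  have e : (x : ℂ) ^ 2 * τ ^ 2 - (y : ℂ) ^ 2 =
      - τ ^ 2 * ((y : ℂ) ^ 2 * (-1 / τ) ^ 2 - (x : ℂ) ^ 2) := by
    field_simp; ring
  rw [e, norm_mul, norm_neg, norm_pow]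
  calc _ = ‖τ‖ ^ 2 * (y ^ 2 * (-1 / τ).im ^ 2) := by ring
    _ ≤ _ := by gcongr

theorem sq_mul_sq_sub_sq_ne_zero {τ : ℂ} (hτ : 0 < τ.im) (m l : ℕ+) :
    ((m : ℕ) : ℂ) ^ 2 * τ ^ 2 - ((l : ℕ) : ℂ) ^ 2 ≠ 0 := by
  have h := le_norm_sq_mul_sq_sub_sq hτ (m : ℕ) (l : ℕ)
  have hm : (0 : ℝ) < (m : ℕ) := by exact_mod_cast m.pos
  push_cast at h
  exact norm_pos_iff.mp (lt_of_lt_of_le (by positivity) h)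

theorem summable_cotDoubleTerm {n : ℕ} (hn : 1 ≤ n) {τ : ℂ} (hτ : 0 < τ.im) :
    Summable (cotDoubleTerm n τ) := by
  obtain ⟨c, hc, h⟩ := exists_le_norm_sq_mul_sq_sub_sq hτ
  have hz : ∀ k : ℕ, 1 < k → Summable (fun m : ℕ+ => 1 / ((m : ℕ) : ℝ) ^ k) := fun k hk =>
    (Real.summable_one_div_nat_pow.mpr hk).comp_injective PNat.coe_injective
  have hs := ((hz (2 * n) (by omega)).mul_of_nonneg (hz 2 (by norm_num))
    (fun _ => by positivity) (fun _ => by positivity)).mul_left c⁻¹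
  refine Summable.of_norm_bounded hs fun p => ?_
  have hm : (0 : ℝ) < (p.1 : ℕ) := by exact_mod_cast p.1.pos
  have hl : (0 : ℝ) < (p.2 : ℕ) := by exact_mod_cast p.2.pos
  have := h (p.1 : ℕ) (p.2 : ℕ)
  push_cast at this
  rw [cotDoubleTerm, norm_div, norm_mul, norm_one, norm_pow, Complex.norm_natCast]
  calc _ ≤ 1 / (((p.1 : ℕ) : ℝ) ^ (2 * n) * (c * ((p.2 : ℕ) : ℝ) ^ 2)) := by gcongr
    _ = _ := by field_simp

/-- This is the Mittag-Leffler expansion of π cot πz, with the cotangent written through e^{2πiz}.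
-/
theorem half_add_div_one_sub_exp {z : ℂ} (hz : 0 < z.im) :
    1 / 2 + Complex.exp (2 * Real.pi * Complex.I * z) /
        (1 - Complex.exp (2 * Real.pi * Complex.I * z)) =
      Complex.I / (2 * Real.pi) * (1 / z + ∑' l : ℕ+, 2 * z / (z ^ 2 - ((l : ℕ) : ℂ) ^ 2)) := by
  have h1 := cot_series_rep (UpperHalfPlane.coe_mem_integerComplement ⟨z, hz⟩)
  have hpi : (Real.pi : ℂ) ≠ 0 := by exact_mod_cast Real.pi_ne_zero
  have hq : 1 - Complex.exp (2 * Real.pi * Complex.I * z) ≠ 0 := by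
    refine one_sub_ne_zero_of_norm_lt_one ?_
    exact UpperHalfPlane.norm_exp_two_pi_I_lt_one ⟨z, hz⟩
  have h2 : ∑' l : ℕ+, 2 * z / (z ^ 2 - ((l : ℕ) : ℂ) ^ 2) =
      ∑' l : ℕ+, (1 / (z - (l : ℕ)) + 1 / (z + (l : ℕ))) := by
    refine tsum_congr fun l => ?_
    have h := sq_mul_sq_sub_sq_ne_zero hz 1 l
    have e : z ^ 2 - ((l : ℕ) : ℂ) ^ 2 = (z - (l : ℕ)) * (z + (l : ℕ)) := by ring
    simp only [PNat.one_coe, Nat.cast_one, one_pow, one_mul] at h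
    rw [e] at h ⊢
    have ha := left_ne_zero_of_mul h
    have hb := right_ne_zero_of_mul h
    field_simp
    ring
  rw [h2]
  simp only at h1
  rw [← h1, Complex.cot_pi_eq_exp_ratio]
  have hI := Complex.I_ne_zero
  field_simp
  ring

/-- The completed Lambert series `ζ(2n+1) / 2 + S_{2n+1}(e^{2πiτ})`. -/
def completedLambert (n : ℕ) (τ : ℂ) : ℂ :=
  riemannZeta (2 * n + 1) / 2 + lambertS (2 * n + 1) (Complex.exp (2 * Real.pi * Complex.I * τ))

/-- Take the cotangent expansion at z = mτ, weight it by m^{-(2n+1)} and sum over m. -/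
theorem completedLambert_eq {n : ℕ} (hn : 1 ≤ n) {τ : ℂ} (hτ : 0 < τ.im) :
    completedLambert n τ = Complex.I / (2 * Real.pi) *
      (riemannZeta (2 * n + 2) / τ + 2 * τ * ∑' p, cotDoubleTerm n τ p) := by
  have h0 : τ ≠ 0 := by rintro rfl; simp at hτ
  set q := Complex.exp (2 * Real.pi * Complex.I * τ) with hqdef
  have hq : ‖q‖ < 1 := UpperHalfPlane.norm_exp_two_pi_I_lt_one ⟨τ, hτ⟩
  have z1 := hasSum_one_div_pnat_pow (k := 2 * n + 1) (by omega)
  have z2 := hasSum_one_div_pnat_pow (k := 2 * n + 2) (by omega)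
  push_cast at z1 z2
  have hS := (z1.div_const 2).add (summable_lambertTerm (2 * n + 1) hq).hasSum
  have hD := summable_cotDoubleTerm hn hτ
  have hR := ((z2.div_const τ).add (hD.prod.hasSum.mul_left (2 * τ))).mul_left
    (Complex.I / (2 * Real.pi))
  rw [← hD.tsum_prod] at hR
  refine (hS.tsum_eq.symm.trans (tsum_congr fun m => ?_)).trans hR.tsum_eq
  have hm : ((m : ℕ) : ℂ) ≠ 0 := by exact_mod_cast m.ne_zero
  have hmim : 0 < (((m : ℕ) : ℂ) * τ).im := by
    have : (0 : ℝ) < (m : ℕ) := by exact_mod_cast m.pos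
    simp [hτ]
  have key := half_add_div_one_sub_exp hmim
  have e1 : Complex.exp (2 * Real.pi * Complex.I * (((m : ℕ) : ℂ) * τ)) = q ^ (m : ℕ) := by
    rw [hqdef, ← Complex.exp_nat_mul]; congr 1; ring
  have e2 : ∑' l : ℕ+, 2 * (((m : ℕ) : ℂ) * τ) / ((((m : ℕ) : ℂ) * τ) ^ 2 - ((l : ℕ) : ℂ) ^ 2) =
      2 * τ * ((m : ℕ) : ℂ) ^ (2 * n + 1) * ∑' l : ℕ+, cotDoubleTerm n τ (m, l) := by
    rw [← tsum_mul_left]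
    refine tsum_congr fun l => ?_
    have := sq_mul_sq_sub_sq_ne_zero hτ m l
    simp only [cotDoubleTerm]
    rw [mul_pow]
    field_simp
    ring
  rw [e1, e2] at key
  have : 1 / ((m : ℕ) : ℂ) ^ (2 * n + 1) / 2 + lambertTerm (2 * n + 1) q m =
      1 / ((m : ℕ) : ℂ) ^ (2 * n + 1) * (1 / 2 + q ^ (m : ℕ) / (1 - q ^ (m : ℕ))) := by
    rw [lambertTerm]; ring
  rw [this, key]
  field_simp
  ring

theorem tsum_cotDoubleTerm_neg_inv {n : ℕ} {τ : ℂ} (hτ : 0 < τ.im) :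
    ∑' p, cotDoubleTerm n (-1 / τ) p = - τ ^ 2 * ∑' p : ℕ+ × ℕ+,
      1 / (((p.2 : ℕ) : ℂ) ^ (2 * n) * (((p.1 : ℕ) : ℂ) ^ 2 * τ ^ 2 - ((p.2 : ℕ) : ℂ) ^ 2)) := by
  have h0 : τ ≠ 0 := by rintro rfl; simp at hτ
  rw [← tsum_mul_left, ← (Equiv.prodComm ℕ+ ℕ+).tsum_eq]
  refine tsum_congr fun p => ?_
  have h1 := sq_mul_sq_sub_sq_ne_zero hτ p.1 p.2
  have hm : ((p.2 : ℕ) : ℂ) ≠ 0 := by exact_mod_cast p.2.ne_zero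
  simp only [cotDoubleTerm, Equiv.prodComm_apply, Prod.fst_swap, Prod.snd_swap]
  have e : ((p.2 : ℕ) : ℂ) ^ 2 * (-1 / τ) ^ 2 - ((p.1 : ℕ) : ℂ) ^ 2 =
      -(((p.1 : ℕ) : ℂ) ^ 2 * τ ^ 2 - ((p.2 : ℕ) : ℂ) ^ 2) / τ ^ 2 := by
    field_simp
    ring
  rw [e]
  field_simp

theorem summable_cotDoubleTerm_swap {n : ℕ} (hn : 1 ≤ n) {τ : ℂ} (hτ : 0 < τ.im) :
    Summable fun p : ℕ+ × ℕ+ =>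
      1 / (((p.2 : ℕ) : ℂ) ^ (2 * n) * (((p.1 : ℕ) : ℂ) ^ 2 * τ ^ 2 - ((p.2 : ℕ) : ℂ) ^ 2)) := by
  have h0 : τ ≠ 0 := by rintro rfl; simp at hτ
  have h := ((Equiv.prodComm ℕ+ ℕ+).summable_iff.mpr
    (summable_cotDoubleTerm hn (im_neg_inv_pos hτ))).mul_left (-1 / τ ^ 2)
  refine h.congr fun p => ?_
  have h1 := sq_mul_sq_sub_sq_ne_zero hτ p.1 p.2
  have hm : ((p.2 : ℕ) : ℂ) ≠ 0 := by exact_mod_cast p.2.ne_zero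
  simp only [cotDoubleTerm, Equiv.prodComm_apply, Prod.fst_swap, Prod.snd_swap, Function.comp]
  have e : ((p.2 : ℕ) : ℂ) ^ 2 * (-1 / τ) ^ 2 - ((p.1 : ℕ) : ℂ) ^ 2 =
      -(((p.1 : ℕ) : ℂ) ^ 2 * τ ^ 2 - ((p.2 : ℕ) : ℂ) ^ 2) / τ ^ 2 := by
    field_simp
    ring
  rw [e]
  field_simp

/-- A finite geometric sum in τ²/l² and 1/m² cancels the mixed denominator m²τ² − l², leaving terms
in which m and l separate; summed over m and l they become products of even zeta values. -/
theorem cotDoubleTerm_sub_swap (n : ℕ) {τ : ℂ} (hτ : 0 < τ.im) (p : ℕ+ × ℕ+) :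
    cotDoubleTerm n τ p - τ ^ (2 * n) *
      (1 / (((p.2 : ℕ) : ℂ) ^ (2 * n) * (((p.1 : ℕ) : ℂ) ^ 2 * τ ^ 2 - ((p.2 : ℕ) : ℂ) ^ 2))) =
      ∑ j ∈ Finset.range n, - τ ^ (2 * j) *
        (1 / ((p.1 : ℕ) : ℂ) ^ (2 * (n - j)) * (1 / ((p.2 : ℕ) : ℂ) ^ (2 * (j + 1)))) := by
  have hm : ((p.1 : ℕ) : ℂ) ≠ 0 := by exact_mod_cast p.1.ne_zero
  have hl : ((p.2 : ℕ) : ℂ) ≠ 0 := by exact_mod_cast p.2.ne_zero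
  have h1 := sq_mul_sq_sub_sq_ne_zero hτ p.1 p.2
  have g := geom_sum₂_mul (τ ^ 2 / ((p.2 : ℕ) : ℂ) ^ 2) (1 / ((p.1 : ℕ) : ℂ) ^ 2) n
  have e : ∑ j ∈ Finset.range n, - τ ^ (2 * j) *
        (1 / ((p.1 : ℕ) : ℂ) ^ (2 * (n - j)) * (1 / ((p.2 : ℕ) : ℂ) ^ (2 * (j + 1)))) =
      -(∑ j ∈ Finset.range n, (τ ^ 2 / ((p.2 : ℕ) : ℂ) ^ 2) ^ j *
        (1 / ((p.1 : ℕ) : ℂ) ^ 2) ^ (n - 1 - j)) /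
        (((p.1 : ℕ) : ℂ) ^ 2 * ((p.2 : ℕ) : ℂ) ^ 2) := by
    rw [← Finset.sum_neg_distrib, Finset.sum_div]
    refine Finset.sum_congr rfl fun j hj => ?_
    have : n - j = n - 1 - j + 1 := by have := Finset.mem_range.mp hj; omega
    rw [this, div_pow, div_pow, one_pow, ← pow_mul, ← pow_mul, ← pow_mul]
    field_simp
    ring
  have hd : τ ^ 2 / ((p.2 : ℕ) : ℂ) ^ 2 - 1 / ((p.1 : ℕ) : ℂ) ^ 2 =
      (((p.1 : ℕ) : ℂ) ^ 2 * τ ^ 2 - ((p.2 : ℕ) : ℂ) ^ 2) /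
        (((p.1 : ℕ) : ℂ) ^ 2 * ((p.2 : ℕ) : ℂ) ^ 2) := by
    field_simp
  rw [e]
  rw [hd, div_pow, div_pow, one_pow, ← pow_mul, ← pow_mul, ← pow_mul] at g
  have hg := eq_div_of_mul_eq (div_ne_zero h1 (by positivity)) g
  rw [hg, cotDoubleTerm]
  field_simp
  ring

theorem tsum_cotDoubleTerm_sub_swap {n : ℕ} (hn : 1 ≤ n) {τ : ℂ} (hτ : 0 < τ.im) :
    ∑' p, cotDoubleTerm n τ p - τ ^ (2 * n) * ∑' p : ℕ+ × ℕ+,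
      1 / (((p.2 : ℕ) : ℂ) ^ (2 * n) * (((p.1 : ℕ) : ℂ) ^ 2 * τ ^ 2 - ((p.2 : ℕ) : ℂ) ^ 2)) =
      ∑ j ∈ Finset.range n, - τ ^ (2 * j) *
        (riemannZeta (2 * (n - j : ℕ)) * riemannZeta (2 * (j + 1 : ℕ))) := by
  have key : ∀ j ∈ Finset.range n, HasSum (fun p : ℕ+ × ℕ+ => - τ ^ (2 * j) *
      (1 / ((p.1 : ℕ) : ℂ) ^ (2 * (n - j)) * (1 / ((p.2 : ℕ) : ℂ) ^ (2 * (j + 1)))))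
      (- τ ^ (2 * j) * (riemannZeta (2 * (n - j : ℕ)) * riemannZeta (2 * (j + 1 : ℕ)))) := by
    intro j hj
    have hj := Finset.mem_range.mp hj
    have z1 := hasSum_one_div_pnat_pow (k := 2 * (n - j)) (by omega)
    have z2 := hasSum_one_div_pnat_pow (k := 2 * (j + 1)) (by omega)
    rw [Nat.cast_mul, Nat.cast_ofNat] at z1 z2
    have hs := summable_mul_of_summable_norm z1.summable.norm z2.summable.norm
    have h12 := z1.mul z2 hs
    have h13 := h12.mul_left (- τ ^ (2 * j))
    exact h13
  have h1 := (summable_cotDoubleTerm hn hτ).hasSum.sub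
    ((summable_cotDoubleTerm_swap hn hτ).hasSum.mul_left (τ ^ (2 * n)))
  simp only [cotDoubleTerm_sub_swap n hτ] at h1
  exact h1.unique (hasSum_sum key)

theorem riemannZeta_mul_riemannZeta_even {n m : ℕ} (hm : m ≤ n + 1) :
    (Real.pi : ℂ) ^ (2 * n + 2) * 2 ^ (2 * n) / (2 * n + 2)! * ((-1) ^ (n + 1) *
      (((2 * n + 2).choose (2 * m) : ℂ) * ((bernoulli (2 * m) : ℚ) : ℂ) *
        ((bernoulli (2 * n + 2 - 2 * m) : ℚ) : ℂ))) =
      riemannZeta (2 * m) * riemannZeta (2 * (n + 1 - m : ℕ)) := by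
  obtain ⟨l, hl⟩ := Nat.exists_eq_add_of_le hm
  have e1 : 2 * n + 2 - 2 * m = 2 * l := by omega
  have e2 : n + 1 - m = l := by omega
  have e3 : 2 * n + 2 = 2 * m + 2 * l := by omega
  rw [e1, e2, riemannZeta_two_mul_nat', riemannZeta_two_mul_nat', hl, e3]
  have hc : ((2 * m + 2 * l).choose (2 * m) : ℂ) =
      (2 * m + 2 * l)! / ((2 * m)! * (2 * l)!) := by
    rw [Nat.cast_choose ℂ (by omega)]
    congr 4
    omega
  have hp : (2 : ℂ) ^ (2 * n) = 2 ^ (2 * m - 1 : ℤ) * 2 ^ (2 * l - 1 : ℤ) := by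
    rw [← zpow_add₀ two_ne_zero, ← zpow_natCast]
    congr 1
    push_cast
    omega
  have hf : ((2 * m + 2 * l)! : ℂ) ≠ 0 := by exact_mod_cast Nat.factorial_ne_zero _
  rw [hc, hp]
  field_simp
  ring

/-- Euler's formula for even zeta values turns each Bernoulli product into a zeta product. The two
end terms contain ζ(0) = −1/2, hence the separate summand. -/
theorem bernoulliH_eq_zeta (n : ℕ) (z : ℂ) :
    (Real.pi : ℂ) ^ (2 * n + 2) * 2 ^ (2 * n) / (2 * n + 2)! * bernoulliH n z =
      ∑ j ∈ Finset.range n, z ^ (2 * j + 1) *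
        (riemannZeta (2 * (n - j : ℕ)) * riemannZeta (2 * (j + 1 : ℕ))) -
      riemannZeta (2 * n + 2) / 2 * (1 / z + z ^ (2 * n + 1)) := by
  have h : (Real.pi : ℂ) ^ (2 * n + 2) * 2 ^ (2 * n) / (2 * n + 2)! * bernoulliH n z =
      ∑ m ∈ Finset.range (n + 2), z ^ (2 * (m : ℤ) - 1) *
        (riemannZeta (2 * m) * riemannZeta (2 * (n + 1 - m : ℕ))) := by
    rw [bernoulliH, Finset.mul_sum, Finset.mul_sum]
    refine Finset.sum_congr rfl fun m hm => ?_
    have hm := Finset.mem_range.mp hm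
    rw [← riemannZeta_mul_riemannZeta_even (show m ≤ n + 1 by omega)]
    ring
  rw [h, Finset.sum_range_succ, Finset.sum_range_succ']
  have e0 : z ^ (2 * ((0 : ℕ) : ℤ) - 1) = z⁻¹ := by simp
  have e1 : z ^ (2 * ((n + 1 : ℕ) : ℤ) - 1) = z ^ (2 * n + 1) := by
    rw [← zpow_natCast]; congr 1; push_cast; ring
  have e2 : ∀ j : ℕ, z ^ (2 * ((j + 1 : ℕ) : ℤ) - 1) = z ^ (2 * j + 1) := fun j => by
    rw [← zpow_natCast]; congr 1; push_cast; ring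
  rw [e0]
  simp only [e1, e2, Nat.sub_self, Nat.sub_zero, Nat.cast_zero, mul_zero, riemannZeta_zero,
    Nat.add_sub_add_right]
  have e3 : (2 * ((n + 1 : ℕ) : ℂ)) = 2 * n + 2 := by push_cast; ring
  have e4 : ∑ j ∈ Finset.range n, z ^ (2 * j + 1) *
        (riemannZeta (2 * (j + 1 : ℕ)) * riemannZeta (2 * (n - j : ℕ))) =
      ∑ j ∈ Finset.range n, z ^ (2 * j + 1) *
        (riemannZeta (2 * (n - j : ℕ)) * riemannZeta (2 * (j + 1 : ℕ))) :=
    Finset.sum_congr rfl fun j _ => by ring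
  rw [e4, e3, one_div]
  ring

/-- Ramanujan's formula for the completed Lambert series. -/
theorem completedLambert_sub_neg_inv {n : ℕ} (hn : 1 ≤ n) {τ : ℂ} (hτ : 0 < τ.im) :
    completedLambert n τ - τ ^ (2 * n) * completedLambert n (-1 / τ) =
      -Complex.I * ((Real.pi : ℂ) ^ (2 * n + 1) * 2 ^ (2 * n) / (2 * n + 2)!) *
        bernoulliH n τ := by
  have h0 : τ ≠ 0 := by rintro rfl; simp at hτ
  have hpi : (Real.pi : ℂ) ≠ 0 := by exact_mod_cast Real.pi_ne_zero
  have hB := bernoulliH_eq_zeta n τ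
  have hD := tsum_cotDoubleTerm_sub_swap hn hτ
  rw [completedLambert_eq hn hτ, completedLambert_eq hn (im_neg_inv_pos hτ),
    tsum_cotDoubleTerm_neg_inv hτ]
  have hs : ∑ j ∈ Finset.range n, τ ^ (2 * j + 1) *
        (riemannZeta (2 * (n - j : ℕ)) * riemannZeta (2 * (j + 1 : ℕ))) =
      -τ * ∑ j ∈ Finset.range n, - τ ^ (2 * j) *
        (riemannZeta (2 * (n - j : ℕ)) * riemannZeta (2 * (j + 1 : ℕ))) := by
    rw [Finset.mul_sum]
    exact Finset.sum_congr rfl fun j _ => by ring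
  rw [hs, ← hD] at hB
  have hR : -Complex.I * ((Real.pi : ℂ) ^ (2 * n + 1) * 2 ^ (2 * n) / (2 * n + 2)!) *
        bernoulliH n τ = -Complex.I / Real.pi * ((Real.pi : ℂ) ^ (2 * n + 2) * 2 ^ (2 * n) /
          (2 * n + 2)! * bernoulliH n τ) := by
    field_simp
    ring
  rw [hR, hB]
  field_simp
  ring

/-! ### Periodicity, the Hecke relation and specialization at √-2. -/

theorem completedLambert_add_one (n : ℕ) (τ : ℂ) :
    completedLambert n (τ + 1) = completedLambert n τ := by
  rw [completedLambert, completedLambert, mul_add, mul_one, Complex.exp_add,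
    Complex.exp_two_pi_mul_I, mul_one]

/-- The Hecke relation at `3` for the completed Lambert series. -/
theorem completedLambert_hecke (n : ℕ) {τ : ℂ} (hτ : 0 < τ.im) :
    3 ^ (2 * n) * (completedLambert n (τ / 3) + completedLambert n ((τ + 1) / 3) +
      completedLambert n ((τ - 1) / 3)) + completedLambert n (3 * τ) =
      (3 ^ (2 * n + 1) + 1) * completedLambert n τ := by
  have hprim := Complex.isPrimitiveRoot_exp 3 (by norm_num)
  set ω := Complex.exp (2 * Real.pi * Complex.I / (3 : ℕ)) with hωdef
  have hω : ω ^ 2 + ω + 1 = 0 := by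
    have := hprim.geom_sum_eq_zero (by norm_num)
    simp only [Finset.sum_range_succ, Finset.sum_range_zero] at this
    linear_combination this
  have h3 : ω ^ 3 = 1 := hprim.pow_eq_one
  set q := Complex.exp (2 * Real.pi * Complex.I * (τ / 3)) with hqdef
  have hq : ‖q‖ < 1 := by
    refine UpperHalfPlane.norm_exp_two_pi_I_lt_one ⟨τ / 3, ?_⟩
    have : (τ / 3).im = τ.im / 3 := by simp
    rw [this]
    positivity
  have e1 : Complex.exp (2 * Real.pi * Complex.I * ((τ + 1) / 3)) = ω * q := by
    rw [hωdef, hqdef, ← Complex.exp_add]; congr 1; push_cast; ring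
  have e2 : Complex.exp (2 * Real.pi * Complex.I * ((τ - 1) / 3)) = ω ^ 2 * q := by
    have : ω * Complex.exp (2 * Real.pi * Complex.I * ((τ - 1) / 3)) = q := by
      rw [hωdef, hqdef, ← Complex.exp_add]; congr 1; push_cast; ring
    linear_combination ω ^ 2 * this - Complex.exp (2 * Real.pi * Complex.I * ((τ - 1) / 3)) * h3
  have e3 : Complex.exp (2 * Real.pi * Complex.I * τ) = q ^ 3 := by
    rw [hqdef, ← Complex.exp_nat_mul]; congr 1; push_cast; ring
  have e4 : Complex.exp (2 * Real.pi * Complex.I * (3 * τ)) = q ^ 9 := by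
    rw [hqdef, ← Complex.exp_nat_mul]; congr 1; push_cast; ring
  have key := sum_lambertS_cubeRoots (2 * n + 1) hω hq
  simp only [completedLambert, e1, e2, e3, e4, ← hqdef]
  have h33 : (3 : ℂ) / 3 ^ (2 * n + 1) * 3 ^ (2 * n) = 1 := by
    rw [pow_succ]; field_simp
  linear_combination 3 ^ (2 * n) * key +
    (lambertS (2 * n + 1) (q ^ 3) - lambertS (2 * n + 1) (q ^ 9)) * h33

theorem sqrtNegTwo_sq : sqrtNegTwo ^ 2 = -2 := by
  rw [sqrtNegTwo, mul_pow, Complex.I_sq, ← Complex.ofReal_pow, Real.sq_sqrt (by norm_num)]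
  norm_num

theorem sqrtNegTwo_ne_zero : sqrtNegTwo ≠ 0 := by
  intro h
  have := sqrtNegTwo_sq
  rw [h] at this
  norm_num at this

theorem sqrtNegTwo_im : sqrtNegTwo.im = √2 := by simp [sqrtNegTwo]

theorem conj_sqrtNegTwo : (starRingEnd ℂ) sqrtNegTwo = -sqrtNegTwo := by simp [sqrtNegTwo]

theorem exp_sqrtNegTwo (a : ℂ) (d : ℕ) (h : 2 * a = d) :
    Complex.exp (2 * Real.pi * Complex.I * (a * sqrtNegTwo)) = (q2 : ℂ) ^ d := by
  rw [q2, Complex.ofReal_exp, ← Complex.exp_nat_mul, ← h, sqrtNegTwo]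
  congr 1
  push_cast
  linear_combination (2 * Real.pi * a * (√2 : ℝ)) * Complex.I_sq

theorem completedLambert_mul_sqrtNegTwo (n : ℕ) (a : ℂ) (d : ℕ) (h : 2 * a = d) :
    completedLambert n (a * sqrtNegTwo) =
      riemannZeta (2 * n + 1) / 2 + lambertS (2 * n + 1) ((q2 : ℂ) ^ d) := by
  rw [completedLambert, exp_sqrtNegTwo a d h]

theorem completedLambert_sqrtNegTwo_relation {n : ℕ} (hn : 1 ≤ n) :
    (3 ^ (2 * n + 1) + 1 - (1 + sqrtNegTwo) ^ (2 * n) - (1 - sqrtNegTwo) ^ (2 * n)) *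
        completedLambert n (1 * sqrtNegTwo) -
      (-2) ^ n * completedLambert n (3 / 2 * sqrtNegTwo) - completedLambert n (3 * sqrtNegTwo) =
      3 ^ (2 * n) * (-Complex.I * ((Real.pi : ℂ) ^ (2 * n + 1) * 2 ^ (2 * n) / (2 * n + 2)!) *
        (bernoulliH n ((1 + sqrtNegTwo) / 3) + bernoulliH n ((sqrtNegTwo - 1) / 3) +
          bernoulliH n (sqrtNegTwo / 3))) := by
  have hs := sqrtNegTwo_sq
  have h2 : (0 : ℝ) < √2 := by positivity
  have him : 0 < sqrtNegTwo.im := by rw [sqrtNegTwo_im]; exact h2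
  have hdiv : ∀ z : ℂ, (z / 3).im = z.im / 3 := fun z => by simp
  have i0 : 0 < (sqrtNegTwo / 3).im := by rw [hdiv]; positivity
  have i1 : 0 < ((1 + sqrtNegTwo) / 3).im := by rw [hdiv]; simpa using him
  have i2 : 0 < ((sqrtNegTwo - 1) / 3).im := by rw [hdiv]; simpa using him
  have hH := completedLambert_hecke n him
  have r0 := completedLambert_sub_neg_inv hn i0
  have r1 := completedLambert_sub_neg_inv hn i1
  have r2 := completedLambert_sub_neg_inv hn i2
  have ne0 := sqrtNegTwo_ne_zero
  have ne1 : 1 + sqrtNegTwo ≠ 0 := by rintro h; rw [h] at i1; simp at i1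
  have ne2 : sqrtNegTwo - 1 ≠ 0 := by rintro h; rw [h] at i2; simp at i2
  -- All three inversions rest on (√-2)² = −2; in the last two, (1 + √-2)(1 − √-2) = 3 cancels the
  -- denominator 3.
  have e0 : -1 / (sqrtNegTwo / 3) = 3 / 2 * sqrtNegTwo := by
    field_simp; linear_combination -hs
  have e1 : -1 / ((1 + sqrtNegTwo) / 3) = sqrtNegTwo - 1 := by
    field_simp; linear_combination -hs
  have e2 : -1 / ((sqrtNegTwo - 1) / 3) = sqrtNegTwo + 1 := by
    field_simp; linear_combination -hs
  have t1 := completedLambert_add_one n (sqrtNegTwo - 1)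
  rw [sub_add_cancel] at t1
  rw [e0, div_pow, pow_mul sqrtNegTwo, hs] at r0
  rw [e1, ← t1, div_pow] at r1
  -- The exponent 2n is even, so √-2 − 1 may be replaced by 1 − √-2.
  rw [e2, completedLambert_add_one, div_pow, pow_mul (sqrtNegTwo - 1), ← neg_sq, neg_sub,
    ← pow_mul] at r2
  rw [add_comm sqrtNegTwo 1] at hH
  rw [one_mul]
  have c0 : ∀ x : ℂ, 3 ^ (2 * n) * (x / 3 ^ (2 * n)) = x := fun x => by field_simp
  have d0 := c0 ((-2) ^ n)
  have d1 := c0 ((1 + sqrtNegTwo) ^ (2 * n))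
  have d2 := c0 ((1 - sqrtNegTwo) ^ (2 * n))
  linear_combination -hH + 3 ^ (2 * n) * (r0 + r1 + r2) +
    completedLambert n (3 / 2 * sqrtNegTwo) * d0 + completedLambert n sqrtNegTwo * (d1 + d2)

/-- H_n has real coefficients and only odd powers of z. -/
theorem bernoulliH_neg_conj (n : ℕ) (z : ℂ) :
    bernoulliH n (-(starRingEnd ℂ) z) = -(starRingEnd ℂ) (bernoulliH n z) := by
  simp only [bernoulliH, map_mul, map_sum, map_pow, map_neg, map_one, map_zpow₀, map_natCast,
    map_ratCast]
  rw [← mul_neg, ← Finset.sum_neg_distrib]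
  congr 1
  refine Finset.sum_congr rfl fun m _ => ?_
  have : Odd (2 * (m : ℤ) - 1) := ⟨m - 1, by ring⟩
  rw [this.neg_zpow]
  ring

/-- The reflection z ↦ −z̄ exchanges (1 + √-2)/3 and (√-2 − 1)/3 and fixes √-2/3, so the real parts
cancel. -/
theorem neg_I_mul_sum_bernoulliH (n : ℕ) :
    -Complex.I * (bernoulliH n ((1 + sqrtNegTwo) / 3) + bernoulliH n ((sqrtNegTwo - 1) / 3) +
          bernoulliH n (sqrtNegTwo / 3)) =
      ((2 * bernoulliH n ((1 + sqrtNegTwo) / 3) + bernoulliH n (sqrtNegTwo / 3)).im : ℝ) := by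
  have h1 := bernoulliH_neg_conj n ((1 + sqrtNegTwo) / 3)
  have h0 := bernoulliH_neg_conj n (sqrtNegTwo / 3)
  have e1 : -(starRingEnd ℂ) ((1 + sqrtNegTwo) / 3) = (sqrtNegTwo - 1) / 3 := by
    simp only [map_div₀, map_add, map_one, conj_sqrtNegTwo, map_ofNat]; ring
  have e0 : -(starRingEnd ℂ) (sqrtNegTwo / 3) = sqrtNegTwo / 3 := by
    simp only [map_div₀, conj_sqrtNegTwo, map_ofNat]; ring
  rw [e1] at h1
  rw [e0] at h0
  rw [h1]
  have hre : (bernoulliH n (sqrtNegTwo / 3)).re = 0 := by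
    have := congrArg Complex.re h0
    rw [Complex.neg_re, Complex.conj_re] at this
    linarith
  apply Complex.ext <;> simp [hre]
  ring

/-! ### Rationality of the Bernoulli side and positivity of b_n. -/

/-- The subfield `ℚ(√-2)` of `ℂ`. -/
def ratSqrtNegTwo : Subfield ℂ where
  carrier := {z | ∃ a b : ℚ, z = a + b * sqrtNegTwo}
  zero_mem' := ⟨0, 0, by simp⟩
  one_mem' := ⟨1, 0, by simp⟩
  add_mem' := by
    rintro _ _ ⟨a, b, rfl⟩ ⟨c, d, rfl⟩
    exact ⟨a + c, b + d, by push_cast; ring⟩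
  neg_mem' := by
    rintro _ ⟨a, b, rfl⟩
    exact ⟨-a, -b, by push_cast; ring⟩
  mul_mem' := by
    rintro _ _ ⟨a, b, rfl⟩ ⟨c, d, rfl⟩
    exact ⟨a * c - 2 * (b * d), a * d + b * c, by
      push_cast; linear_combination (b : ℂ) * d * sqrtNegTwo_sq⟩
  inv_mem' := by
    rintro _ ⟨a, b, rfl⟩
    refine ⟨a / (a ^ 2 + 2 * b ^ 2), -b / (a ^ 2 + 2 * b ^ 2), ?_⟩
    by_cases h : a ^ 2 + 2 * b ^ 2 = 0
    · have ha : a = 0 := by nlinarith [sq_nonneg a, sq_nonneg b]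
      have hb : b = 0 := by nlinarith [sq_nonneg a, sq_nonneg b]
      simp [ha, hb]
    · have h' : (a : ℂ) ^ 2 + 2 * (b : ℂ) ^ 2 ≠ 0 := by exact_mod_cast h
      have hn : ((a : ℂ) + b * sqrtNegTwo) * (a - b * sqrtNegTwo) = a ^ 2 + 2 * (b : ℂ) ^ 2 := by
        linear_combination -(b : ℂ) ^ 2 * sqrtNegTwo_sq
      refine inv_eq_of_mul_eq_one_right ?_
      push_cast
      rw [← hn, show (a : ℂ) / ((a + b * sqrtNegTwo) * (a - b * sqrtNegTwo)) +
        -b / ((a + b * sqrtNegTwo) * (a - b * sqrtNegTwo)) * sqrtNegTwo =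
        (a - b * sqrtNegTwo) / ((a + b * sqrtNegTwo) * (a - b * sqrtNegTwo)) by ring,
        ← mul_div_assoc, div_self (hn ▸ h')]

theorem sqrtNegTwo_mem : sqrtNegTwo ∈ ratSqrtNegTwo := ⟨0, 1, by simp⟩

theorem bernoulliH_mem {K : Subfield ℂ} (n : ℕ) {z : ℂ} (hz : z ∈ K) : bernoulliH n z ∈ K := by
  refine K.mul_mem (K.pow_mem (K.neg_mem K.one_mem) _) (K.sum_mem fun m _ => ?_)
  exact K.mul_mem (K.mul_mem (K.mul_mem (K.zpow_mem hz _) (natCast_mem K _))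
    (SubfieldClass.ratCast_mem K _)) (SubfieldClass.ratCast_mem K _)

theorem exists_im_eq_mul_sqrt_two {z : ℂ} (hz : z ∈ ratSqrtNegTwo) : ∃ r : ℚ, z.im = r * √2 := by
  obtain ⟨a, b, rfl⟩ := hz
  exact ⟨b, by simp [sqrtNegTwo]⟩

theorem exists_im_bernoulliH_eq (n : ℕ) :
    ∃ r : ℚ, (2 * bernoulliH n ((1 + sqrtNegTwo) / 3) + bernoulliH n (sqrtNegTwo / 3)).im =
      r * √2 := by
  have h := sqrtNegTwo_mem
  have h3 : (3 : ℂ) ∈ ratSqrtNegTwo := ofNat_mem _ 3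
  exact exists_im_eq_mul_sqrt_two (add_mem (mul_mem (ofNat_mem _ 2)
    (bernoulliH_mem n (div_mem (add_mem (one_mem _) h) h3))) (bernoulliH_mem n (div_mem h h3)))

/-- The last identity is multiplicativity of the norm, 1 + √-2 having norm 3; it bounds a in the
proof that b_n > 0. -/
theorem exists_int_pow_one_add_sqrtNegTwo (m : ℕ) :
    ∃ a b : ℤ, (1 + sqrtNegTwo) ^ m = a + b * sqrtNegTwo ∧
      (1 - sqrtNegTwo) ^ m = a - b * sqrtNegTwo ∧ a ^ 2 + 2 * b ^ 2 = 3 ^ m := by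
  induction m with
  | zero => exact ⟨1, 0, by simp, by simp, by norm_num⟩
  | succ m ih =>
    obtain ⟨a, b, h1, h2, h3⟩ := ih
    refine ⟨a - 2 * b, a + b, ?_, ?_, ?_⟩
    · rw [pow_succ, h1]; push_cast; linear_combination (b : ℂ) * sqrtNegTwo_sq
    · rw [pow_succ, h2]; push_cast; linear_combination (b : ℂ) * sqrtNegTwo_sq
    · rw [pow_succ]; linear_combination 3 * h3

theorem exists_int_eq_bSeq {n : ℕ} (hn : 1 ≤ n) : ∃ b : ℤ, (b : ℂ) = bSeq n ∧ 0 < b := by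
  obtain ⟨a, c, h1, h2, h3⟩ := exists_int_pow_one_add_sqrtNegTwo (2 * n)
  refine ⟨3 ^ (2 * n + 1) - (-2) ^ n - 2 * a, ?_, ?_⟩
  · rw [bSeq, h1, h2]; push_cast; ring
  · have ha : a ≤ 3 ^ n := by
      refine le_of_sq_le_sq ?_ (by positivity)
      rw [← pow_mul, mul_comm n 2]
      nlinarith [sq_nonneg c]
    have hb : (-2 : ℤ) ^ n ≤ 3 ^ n := by
      calc (-2 : ℤ) ^ n ≤ |(-2) ^ n| := le_abs_self _
        _ = 2 ^ n := by rw [abs_pow]; norm_num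
        _ ≤ 3 ^ n := by gcongr; norm_num
    have hc : (3 : ℤ) ≤ 3 ^ n := by
      calc (3 : ℤ) = 3 ^ 1 := by norm_num
        _ ≤ 3 ^ n := by gcongr; norm_num
    have hd : (3 : ℤ) ^ (2 * n + 1) = 3 * (3 ^ n * 3 ^ n) := by ring
    rw [hd]
    -- With x = 3^n ≥ 3, the quantity is at least 3x² − x − 2x > 0.
    nlinarith

theorem q2_pos : 0 < q2 := Real.exp_pos _

theorem q2_lt_one : q2 < 1 := by
  rw [q2, Real.exp_lt_one_iff]
  have := Real.pi_pos
  have : (0 : ℝ) < √2 := by positivity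
  have := mul_pos Real.pi_pos this
  linarith

theorem norm_q2_pow_lt_one {d : ℕ} (hd : d ≠ 0) : ‖(q2 : ℂ) ^ d‖ < 1 := by
  rw [norm_pow, Complex.norm_real, Real.norm_of_nonneg q2_pos.le]
  exact pow_lt_one₀ q2_pos.le q2_lt_one hd

/-! ### Solving for ζ(2n+1). -/

theorem bSeq_mul_zeta {n : ℕ} (hn : 1 ≤ n) {r : ℚ}
    (hr : (2 * bernoulliH n ((1 + sqrtNegTwo) / 3) + bernoulliH n (sqrtNegTwo / 3)).im = r * √2) :
    bSeq n * (riemannZeta (2 * n + 1) / 2) =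
      3 ^ (2 * n) * ((Real.pi : ℂ) ^ (2 * n + 1) * 2 ^ (2 * n) / (2 * n + 2)!) *
        (r * ((√2 : ℝ) : ℂ)) -
      (bSeq n + (-2) ^ n + 1) * lambertS (2 * n + 1) ((q2 : ℂ) ^ 2) +
      (-2) ^ n * lambertS (2 * n + 1) ((q2 : ℂ) ^ 3) +
      lambertS (2 * n + 1) ((q2 : ℂ) ^ 6) := by
  have h := completedLambert_sqrtNegTwo_relation hn
  have hI := neg_I_mul_sum_bernoulliH n
  rw [hr] at hI
  push_cast at hI
  rw [completedLambert_mul_sqrtNegTwo n 1 2 (by norm_num),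
    completedLambert_mul_sqrtNegTwo n (3 / 2) 3 (by norm_num),
    completedLambert_mul_sqrtNegTwo n 3 6 (by norm_num)] at h
  rw [bSeq]
  linear_combination h + 3 ^ (2 * n) *
    ((Real.pi : ℂ) ^ (2 * n + 1) * 2 ^ (2 * n) / (2 * n + 2)!) * hI

end

theorem mainTheorem2 (n : ℕ) (hn : 1 ≤ n) :
    ∃ (b : ℤ) (B : ℕ → ℚ),
      -- the integer `b_n`
      (b : ℂ) = bSeq n ∧ 0 < b ∧
      -- the coefficients of the Lambert series
      B 6 = B 3 / (-2) ^ n ∧ B 6 = 2 / b ∧ ∑ d ∈ ({2, 3, 6} : Finset ℕ), B d = -2 ∧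
      -- the coefficient of `√2 π ^ k`
      (((((2 * n + 3)! : ℚ) / 2 ^ (2 * n - 1) * b * B 0 : ℚ)) : ℝ) =
        4 * (2 * n + 3) * 3 ^ (2 * n) / √2 *
          (2 * bernoulliH n ((1 + sqrtNegTwo) / 3) + bernoulliH n (sqrtNegTwo / 3)).im ∧
      -- convergence of the three Lambert series
      (∀ d ∈ ({2, 3, 6} : Finset ℕ), Summable (lambertTerm (2 * n + 1) ((q2 : ℂ) ^ d))) ∧
      -- the evaluation of `ζ(2n+1)`
      riemannZeta (2 * n + 1) =
        (B 0 : ℂ) * ((√2 : ℝ) : ℂ) * (Real.pi : ℂ) ^ (2 * n + 1) +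
          ∑ d ∈ ({2, 3, 6} : Finset ℕ), (B d : ℂ) * lambertS (2 * n + 1) ((q2 : ℂ) ^ d) := by
  obtain ⟨b, hb, hpos⟩ := exists_int_eq_bSeq hn
  obtain ⟨r, hr⟩ := exists_im_bernoulliH_eq n
  have hbQ : (b : ℚ) ≠ 0 := by exact_mod_cast hpos.ne'
  have hbC : (b : ℂ) ≠ 0 := by exact_mod_cast hpos.ne'
  have h2n : (-2 : ℚ) ^ n ≠ 0 := pow_ne_zero _ (by norm_num)
  -- These are the coefficients of `bSeq_mul_zeta` multiplied by 2/b. Index 0 holds the coefficient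
  -- of √2 π^k; the final default matters only at d = 6.
  refine ⟨b, fun d => if d = 0 then 2 ^ (2 * n + 1) * 3 ^ (2 * n) * r / (b * (2 * n + 2)!)
    else if d = 2 then -2 * (b + (-2) ^ n + 1) / b
    else if d = 3 then 2 * (-2) ^ n / b else 2 / b, hb, hpos, ?_, ?_, ?_, ?_, ?_, ?_⟩
  · norm_num
    field_simp
  · norm_num
  · norm_num
    field_simp
    ring
  · rw [hr]
    have hf : ((2 * n + 3)! : ℚ) = (2 * n + 3) * (2 * n + 2)! := by
      rw [Nat.factorial_succ]; push_cast; ring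
    -- The truncated subtraction 2n − 1 is a true one because n ≥ 1.
    have hp : (2 : ℚ) ^ (2 * n + 1) = 4 * 2 ^ (2 * n - 1) := by
      rw [show 2 * n + 1 = 2 * n - 1 + 2 by omega, pow_add]; norm_num; ring
    have hfac : ((2 * n + 2)! : ℚ) ≠ 0 := by exact_mod_cast Nat.factorial_ne_zero _
    have hs : √(2 : ℝ) ≠ 0 := by positivity
    have e : ((2 * n + 3)! : ℚ) / 2 ^ (2 * n - 1) * b *
        (2 ^ (2 * n + 1) * 3 ^ (2 * n) * r / (b * (2 * n + 2)!)) =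
        4 * (2 * n + 3) * 3 ^ (2 * n) * r := by
      rw [hf, hp]
      field_simp
    beta_reduce
    rw [if_pos rfl, e]
    push_cast
    field_simp
  · intro d hd
    refine summable_lambertTerm _ (norm_q2_pow_lt_one ?_)
    rintro rfl
    simp at hd
  · have key := bSeq_mul_zeta hn hr
    rw [← hb] at key
    have hfac : ((2 * n + 2)! : ℂ) ≠ 0 := by exact_mod_cast Nat.factorial_ne_zero _
    have hz : riemannZeta (2 * n + 1) = 2 / b * (b * (riemannZeta (2 * n + 1) / 2)) := by
      field_simp
    rw [hz, key]
    norm_num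
    field_simp
    ring
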